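/- Let $d\ge 0$ be an integer. For $n\in\mathbb N$ let $\mathcal X_n$ be the set of all continuous paths $\mathbf x:[0,T]\to\mathbb R^n$ of bounded variation with $\mathbf x(0)=0$, where the end time $T=T_{\mathbf x}>0$ may depend on the path. Equip $\mathcal X_n$ with the 1-variation metric $$\rho(\mathbf x,\mathbf y)=|T_{\mathbf x}-T_{\mathbf y}|+\big\|\mathbf x(\cdot\wedge T_{\mathbf x})-\mathbf y(\cdot\wedge T_{\mathbf y})\big\|_{1},\qquad \|\mathbf z\|_1=\sup_{t_0<\dots<t_N}\sum_{i=1}^N|\mathbf z(t_i)-\mathbf z(t_{i-1})|,$$ so that $\rho(\mathbf x,\mathbf y)=\|\mathbf x-\mathbf y\|_1$ when $T_{\mathbf x}=T_{\mathbf y}$, and with the corresponding Borel $\sigma$-algebra; subsets carry the subspace structures. For $\mathbf x\in\mathcal X_n$ and $m\ge 0$ let $$\int d\mathbf x^{\otimes m}=\Big(\int_{0<t_1<\dots<t_m<T}d\mathbf x^{i_1}(t_1)\cdots d\mathbf x^{i_m}(t_m)\Big)_{i_1,\dots,i_m}\in(\mathbb R^n)^{\otimes m}$$ (iterated Stieltjes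 integrals; equal to $1$ for $m=0$), let $\Phi_{\mathsf{Sig}}(\mathbf x)=(\int d\mathbf x^{\otimes m})_{m\ge 0}$ be the signature of $\mathbf x$, and for $\mathbf w\in\bigoplus_{m\ge0}(\mathbb R^n)^{\otimes m}$ (finitely many non-zero coordinates) let $\langle\mathbf w,\Phi_{\mathsf{Sig}}(\mathbf x)\rangle$ be the sum of the products of corresponding coordinates. For $\mathbf x\in\mathcal X_d$ let $\bar{\mathbf x}\in\mathcal X_{d+1}$ be the time-augmented path $\bar{\mathbf x}(t)=(t,\mathbf x(t))$, $t\in[0,T_{\mathbf x}]$. Let $\mathcal K\subset\mathcal X_d$ be compact and $\bar{\mathcal K}=\{\bar{\mathbf x}:\mathbf x\in\mathcal K\}\subset\mathcal X_{d+1}$. 1. For every $f\in C_b(\bar{\mathcal K},\mathbb R)$ and $\epsilon>0$ there is $\mathbf w\in\bigoplus_{m\ge 0}(\mathbb R^{d+1})^{\otimes m}$ such that $\sup_{\mathbf x\in\mathcal K}|f(\bar{\mathbf x})-\langle\mathbf w,\Phi_{\mathsf{Sig}}(\bar{\mathbf x})\rangle|<\epsilon$. 2. For every $\mathcal K$-valued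 random variable $\mathbf X$ and every $m\ge 0$ the expectation $\mathbb E[\int d\bar{\mathbf X}^{\otimes m}]$ exists, and the expected signature map $\operatorname{Law}(\bar{\mathbf X})\mapsto\mathbb E[\Phi_{\mathsf{Sig}}(\bar{\mathbf X})]=(\mathbb E[\int d\bar{\mathbf X}^{\otimes m}])_{m\ge0}$ is injective: if $\mathbf X,\mathbf Y$ are $\mathcal K$-valued random variables (possibly on different probability spaces) with the same expected signature of $\bar{\mathbf X}$ and $\bar{\mathbf Y}$, then $\operatorname{Law}(\bar{\mathbf X})=\operatorname{Law}(\bar{\mathbf Y})$. 3. For $\mathcal K$-valued random variables $\mathbf X,\mathbf X_1,\mathbf X_2,\dots$ (possibly on different probability spaces) the following are equivalent: (a) for all $f\in C_b(\bar{\mathcal K},\mathbb R)$, $\lim_{k\to\infty}\mathbb E[f(\bar{\mathbf X}_k)]=\mathbb E[f(\bar{\mathbf X})]$; (b) for all $m\in\mathbb N$, $\lim_{k\to\infty}\mathbb E[\int d\bar{\mathbf X}_k^{\otimes m}]=\mathbb E[\int d\bar{\mathbf X}^{\otimes m}]$. -/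

import Mathlib

open MeasureTheory Filter Topology
open scoped ENNReal BoundedContinuousFunction

/-- A continuous path `x : [0, T] → ℝⁿ` of bounded variation with `x 0 = 0`; the end time `T > 0`
is part of the data, so that different paths may live on different intervals. -/
structure BVPath (n : ℕ) where
  T : ℝ
  T_pos : 0 < T
  toFun : C(Set.Icc (0 : ℝ) T, EuclideanSpace ℝ (Fin n))
  boundedVariation : BoundedVariationOn toFun Set.univ
  map_zero : toFun ⟨0, Set.left_mem_Icc.2 T_pos.le⟩ = 0

/-- Subadditivity of the variation under a pointwise bound on increments. -/
theorem eVariationOn_le_add_of_edist_le {α E F G : Type*} [LinearOrder α]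
    [PseudoEMetricSpace E] [PseudoEMetricSpace F] [PseudoEMetricSpace G]
    {f : α → E} {g : α → F} {h : α → G} {s : Set α}
    (H : ∀ a b, edist (h a) (h b) ≤ edist (f a) (f b) + edist (g a) (g b)) :
    eVariationOn h s ≤ eVariationOn f s + eVariationOn g s := by
  refine iSup_le fun p => ?_
  calc _ ≤ ∑ i ∈ Finset.range p.1, (edist (f (p.2.1 (i + 1))) (f (p.2.1 i)) +
          edist (g (p.2.1 (i + 1))) (g (p.2.1 i))) := Finset.sum_le_sum fun i _ => H _ _
    _ = _ := Finset.sum_add_distrib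
    _ ≤ _ := add_le_add (eVariationOn.sum_le p.2.2.1 p.2.2.2)
        (eVariationOn.sum_le p.2.2.1 p.2.2.2)

namespace BVPath

/-- The path stopped at its end time: equal to `x` on `[0, T]`, to `x T` after time `T`, and to
`x 0 = 0` before time `0`. -/
noncomputable def stopped {n : ℕ} (x : BVPath n) : ℝ → EuclideanSpace ℝ (Fin n) :=
  Set.IccExtend x.T_pos.le x.toFun

theorem stopped_boundedVariation {n : ℕ} (x : BVPath n) :
    BoundedVariationOn x.stopped Set.univ :=
  ne_top_of_le_ne_top x.boundedVariation
    (eVariationOn.comp_le_of_monotoneOn _ _ ((Set.monotone_projIcc x.T_pos.le).monotoneOn _)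
      fun _ _ => Set.mem_univ _)

theorem stopped_zero {n : ℕ} (x : BVPath n) : x.stopped 0 = 0 := by
  rw [stopped, Set.IccExtend_of_mem _ _ (Set.left_mem_Icc.2 x.T_pos.le)]
  exact x.map_zero

theorem coord_boundedVariation {n : ℕ} (x : BVPath n) (i : Fin n) :
    BoundedVariationOn (fun t => x.stopped t i) Set.univ :=
  (EuclideanSpace.proj (𝕜 := ℝ) i : EuclideanSpace ℝ (Fin n) →L[ℝ] ℝ).lipschitz.comp_boundedVariationOn
    x.stopped_boundedVariation

theorem sub_boundedVariation {n : ℕ} (x y : BVPath n) :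
    BoundedVariationOn (fun t => x.stopped t - y.stopped t) Set.univ :=
  ne_top_of_le_ne_top (ENNReal.add_ne_top.2 ⟨x.stopped_boundedVariation,
    y.stopped_boundedVariation⟩)
    (eVariationOn_le_add_of_edist_le fun a b => by
      have := edist_add_add_le (x.stopped a) (-y.stopped a) (x.stopped b) (-y.stopped b)
      rwa [edist_neg_neg, ← sub_eq_add_neg, ← sub_eq_add_neg] at this)

/-- The 1-variation metric: the 1-variation of the difference of the two stopped paths plus the
distance of the end times. On paths with the same interval `[0, T]` it is `‖x - y‖₁`. -/
noncomputable instance instMetricSpace (n : ℕ) : MetricSpace (BVPath n) where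
  dist x y := |x.T - y.T| +
    (eVariationOn (fun t => x.stopped t - y.stopped t) Set.univ).toReal
  dist_self x := by
    have : eVariationOn (fun t => x.stopped t - x.stopped t) Set.univ = 0 := by
      rw [eVariationOn.eq_zero_iff]; simp
    rw [this, sub_self, abs_zero, ENNReal.toReal_zero, add_zero]
  dist_comm x y := by
    have : eVariationOn (fun t => x.stopped t - y.stopped t) Set.univ =
        eVariationOn (fun t => y.stopped t - x.stopped t) Set.univ := by
      have h (a b : ℝ) : edist (x.stopped a - y.stopped a) (x.stopped b - y.stopped b) =
          edist (y.stopped a - x.stopped a) (y.stopped b - x.stopped b) := by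
        rw [← edist_neg_neg, neg_sub, neg_sub]
      simp only [eVariationOn, h]
    simp only [this, abs_sub_comm]
  dist_triangle x y z := by
    have h : eVariationOn (fun t => x.stopped t - z.stopped t) Set.univ ≤
        eVariationOn (fun t => x.stopped t - y.stopped t) Set.univ +
          eVariationOn (fun t => y.stopped t - z.stopped t) Set.univ :=
      eVariationOn_le_add_of_edist_le fun a b => by
        have := edist_add_add_le (x.stopped a - y.stopped a) (y.stopped a - z.stopped a)
          (x.stopped b - y.stopped b) (y.stopped b - z.stopped b)
        simpa using this
    have h1 := ENNReal.toReal_mono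
      (ENNReal.add_ne_top.2 ⟨sub_boundedVariation x y, sub_boundedVariation y z⟩) h
    rw [ENNReal.toReal_add (sub_boundedVariation x y) (sub_boundedVariation y z)] at h1
    have h2 := abs_sub_le x.T y.T z.T
    linarith
  eq_of_dist_eq_zero {x y} h := by
    have h0 : 0 ≤ |x.T - y.T| := abs_nonneg _
    have h1 : 0 ≤ (eVariationOn (fun t => x.stopped t - y.stopped t) Set.univ).toReal :=
      ENNReal.toReal_nonneg
    have hT : x.T = y.T := by
      have : |x.T - y.T| = 0 := by linarith
      exact sub_eq_zero.1 (abs_eq_zero.1 this)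
    have hv : eVariationOn (fun t => x.stopped t - y.stopped t) Set.univ = 0 := by
      have : (eVariationOn (fun t => x.stopped t - y.stopped t) Set.univ).toReal = 0 := by
        linarith
      exact (ENNReal.toReal_eq_zero_iff _).1 this |>.resolve_right (sub_boundedVariation x y)
    have hs : ∀ t, x.stopped t = y.stopped t := fun t => by
      have := (eVariationOn.eq_zero_iff _).1 hv t (Set.mem_univ _) 0 (Set.mem_univ _)
      rw [edist_eq_zero, stopped_zero, stopped_zero, sub_zero] at this
      exact sub_eq_zero.1 this
    obtain ⟨T, hT0, f, hf, hf0⟩ := x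
    obtain ⟨T', hT0', g, hg, hg0⟩ := y
    obtain rfl : T = T' := hT
    obtain rfl : f = g := by
      ext1 t
      simpa [stopped, Set.IccExtend_of_mem _ _ t.2] using hs t
    rfl

/-- The path space carries its Borel `σ`-algebra. -/
noncomputable instance instMeasurableSpace (n : ℕ) : MeasurableSpace (BVPath n) := borel _

instance instBorelSpace (n : ℕ) : BorelSpace (BVPath n) := ⟨rfl⟩

/-- The time-augmented path `t ↦ (t, x t)` in `ℝⁿ⁺¹`, on the same interval `[0, T]`. -/
noncomputable def timeAugment {n : ℕ} (x : BVPath n) : BVPath (n + 1) where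
  T := x.T
  T_pos := x.T_pos
  toFun :=
    { toFun := fun t => WithLp.toLp 2 (Fin.cons (t : ℝ) (x.toFun t) : Fin (n + 1) → ℝ)
      continuous_toFun := by
        refine (PiLp.continuous_toLp 2 _).comp (continuous_pi fun i => ?_)
        refine Fin.cases ?_ (fun j => ?_) i
        · simpa using continuous_subtype_val
        · simp only [Fin.cons_succ]
          fun_prop }
  boundedVariation := by
    refine ne_top_of_le_ne_top (ENNReal.add_ne_top.2 ⟨?_, x.boundedVariation⟩)
      (eVariationOn_le_add_of_edist_le (f := fun t : Set.Icc (0 : ℝ) x.T => (t : ℝ))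
        fun a b => ?_)
    · refine MonotoneOn.boundedVariationOn (C := x.T) (fun a _ b _ h => h) fun t _ => ?_
      rw [abs_of_nonneg t.2.1]
      exact t.2.2
    · simp only [ContinuousMap.coe_mk, edist_dist]
      rw [← ENNReal.ofReal_add dist_nonneg dist_nonneg]
      refine ENNReal.ofReal_le_ofReal ?_
      rw [EuclideanSpace.dist_eq, EuclideanSpace.dist_eq, Fin.sum_univ_succ]
      simp only [Fin.cons_zero, Fin.cons_succ]
      have hs : 0 ≤ ∑ i, dist (x.toFun a i) (x.toFun b i) ^ 2 :=
        Finset.sum_nonneg fun _ _ => sq_nonneg _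
      rw [Real.sqrt_le_iff]
      refine ⟨by positivity, ?_⟩
      nlinarith [Real.sq_sqrt hs, Real.sqrt_nonneg (∑ i, dist (x.toFun a i) (x.toFun b i) ^ 2),
        dist_nonneg (x := (a : ℝ)) (y := (b : ℝ))]
  map_zero := by
    ext i
    refine Fin.cases ?_ (fun j => ?_) i
    · simp
    · simp [x.map_zero]

/-- The iterated Stieltjes integrals of `x` up to time `t`,
`∫_{0 < t₁ < ⋯ < tₘ < t} dx^{i₁}(t₁) ⋯ dx^{iₘ}(tₘ)`,
computed by integrating out `t₁`, then `t₂`, and so on, against the signed Stieltjes measures of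
the coordinate paths. -/
noncomputable def iteratedIntegral {n : ℕ} (x : BVPath n) :
    (m : ℕ) → (Fin m → Fin n) → ℝ → ℝ
  | 0, _, _ => 1
  | m + 1, I, t =>
    ∫ᵛ s in Set.Ioo 0 t, iteratedIntegral x m (Fin.init I) s
      ∂•(x.coord_boundedVariation (I (Fin.last m))).vectorMeasure

/-- The degree `m` part `∫ dx^{⊗m}` of the signature, an element of `(ℝⁿ)^{⊗m}` given by its
coordinates `(i₁, …, iₘ)`. -/
noncomputable def signature {n : ℕ} (x : BVPath n) (m : ℕ) : (Fin m → Fin n) → ℝ :=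
  fun I => x.iteratedIntegral m I x.T

/-- The pairing `⟨w, Φ(x)⟩ = ∑_I w^I ∫ dx^{i₁} ⋯ dx^{iₘ}` of the signature with
`w ∈ ⨁ₘ (ℝⁿ)^{⊗m}`, where `w` is given by its coordinates `w^I`, of which only finitely many are
non-zero, `I` ranging over the multi-indices of all lengths. -/
noncomputable def pairing {n : ℕ} (w : (Σ m : ℕ, (Fin m → Fin n)) →₀ ℝ) (x : BVPath n) : ℝ :=
  w.sum fun I c => c * x.signature I.1 I.2

/-- The map `x ↦ x̄` from `K` to `K̄ = {x̄ : x ∈ K}`; the latter has the subspace topology. -/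
noncomputable def augmentOn {n : ℕ} (K : Set (BVPath n)) (x : K) : (timeAugment '' K) :=
  ⟨timeAugment x, Set.mem_image_of_mem _ x.2⟩

end BVPath

/-!
Integration by parts writes a product of two iterated integrals as a linear combination of iterated
integrals, so the linear functionals of the signature form an algebra, and each of them is
continuous for the 1-variation metric because the total variation of a Stieltjes measure is
controlled by the 1-variation of the path. For a time-augmented path this algebra contains the end
time `T` and all moments `∫₀ᵀ xʲ(s) sᵏ ds`; by Weierstrass' theorem the moments determine the
continuous function `xʲ` on `[0, T]`, so the algebra separates points. On a compact set
Stone–Weierstrass gives the approximation, a separating algebra determines finite measures, and,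
all families of measures being tight there, it also determines weak convergence.
-/

/-! ### Signed measures and their integrals -/

theorem iUnion_Ioc_neg_natCast : ⋃ n : ℕ, Set.Ioc (-(n : ℝ)) n = Set.univ := by
  refine Set.eq_univ_of_forall fun x => ?_
  obtain ⟨n, hn⟩ := exists_nat_gt |x|
  exact Set.mem_iUnion.2 ⟨n, (abs_lt.1 hn).1, (abs_lt.1 hn).2.le⟩

theorem monotone_Ioc_neg_natCast : Monotone fun n : ℕ => Set.Ioc (-(n : ℝ)) n :=
  fun _ _ h => Set.Ioc_subset_Ioc (neg_le_neg (Nat.cast_le.2 h)) (Nat.cast_le.2 h)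

theorem vectorMeasure_ext_of_Ioc {M : Type*} [AddCommGroup M] [TopologicalSpace M] [T2Space M]
    {μ ν : VectorMeasure ℝ M} (h : ∀ a b, a ≤ b → μ (Set.Ioc a b) = ν (Set.Ioc a b)) : μ = ν := by
  have hgen : (inferInstance : MeasurableSpace ℝ) =
      .generateFrom {S | ∃ l u : ℝ, l < u ∧ Set.Ioc l u = S} :=
    BorelSpace.measurable_eq.trans (borel_eq_generateFrom_Ioc ℝ)
  refine VectorMeasure.ext_of_generateFrom _ ?_ hgen (isPiSystem_Ioc id id) ?_
  · rintro _ ⟨a, b, hab, rfl⟩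
    exact h a b hab.le
  · have hlim (ρ : VectorMeasure ℝ M) :
        Tendsto (fun n : ℕ => ρ (Set.Ioc (-(n : ℝ)) n)) atTop (𝓝 (ρ Set.univ)) := by
      rw [← iUnion_Ioc_neg_natCast]
      exact VectorMeasure.tendsto_vectorMeasure_iUnion_atTop_nat monotone_Ioc_neg_natCast
        fun _ => measurableSet_Ioc
    exact tendsto_nhds_unique (hlim μ) ((hlim ν).congr fun n =>
      (h _ _ (by linarith [n.cast_nonneg (α := ℝ)])).symm)

theorem variation_le_of_forall_Ioc {E : Type*} [NormedAddCommGroup E] [CompleteSpace E]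
    {μ : VectorMeasure ℝ E} {ν : Measure ℝ} [IsFiniteMeasure ν]
    (h : ∀ a b, a ≤ b → ‖μ (Set.Ioc a b)‖ₑ ≤ ν (Set.Ioc a b)) : μ.variation ≤ ν := by
  have hsub {a b : ℝ} (hab : a ≤ b) : μ (Set.Iic b) - μ (Set.Iic a) = μ (Set.Ioc a b) := by
    rw [← Set.Iic_union_Ioc_eq_Iic hab, VectorMeasure.of_union
      (Set.Iic_disjoint_Ioc le_rfl) measurableSet_Iic measurableSet_Ioc, add_sub_cancel_left]
  have hgen : (inferInstance : MeasurableSpace ℝ) =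
      .generateFrom {s | ∃ u v : ℝ, u ≤ v ∧ s = Set.Ioc u v} := by
    rw [BorelSpace.measurable_eq (α := ℝ), borel_eq_generateFrom_Ioc_le ℝ]
    simp only [eq_comm]
  obtain ⟨m, hm, hmν⟩ :=
    VectorMeasure.exists_extension_of_isSetSemiring_of_le_measure_of_generateFrom (μ := ν)
      (m := AddContent.onIoc fun t => μ (Set.Iic t)) IsSetSemiring.Ioc
      (by
        rintro _ ⟨a, b, hab, rfl⟩
        rw [AddContent.onIoc_apply hab, hsub hab]
        exact h a b hab) hgen
  obtain rfl : μ = m := vectorMeasure_ext_of_Ioc fun a b hab => by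
    rw [hm _ ⟨a, b, hab, rfl⟩, AddContent.onIoc_apply hab, hsub hab]
  exact VectorMeasure.variation_le_of_forall_enorm_le fun s _ => hmν s

section SignedMeasure

variable {X : Type*} [MeasurableSpace X]

instance isFiniteMeasure_variation (μ : SignedMeasure X) : IsFiniteMeasure μ.variation := by
  rw [← SignedMeasure.totalVariation_eq_variation]
  infer_instance

theorem integral_toSignedMeasure (μ : Measure X) [IsFiniteMeasure μ] (f : X → ℝ) :
    ∫ᵛ x, f x ∂•μ.toSignedMeasure = ∫ x, f x ∂μ := by
  have hflip : ContinuousLinearMap.lsmul ℝ ℝ =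
      (ContinuousLinearMap.lsmul ℝ ℝ : ℝ →L[ℝ] ℝ →L[ℝ] ℝ).flip := by
    ext; simp
  rw [hflip, VectorMeasure.integral_toSignedMeasure]

theorem integrable_mul_iff_of_abs_eq_one {μ : Measure X} {f h : X → ℝ} (hh : Measurable h)
    (habs : ∀ x, |h x| = 1) : Integrable (fun x => h x * f x) μ ↔ Integrable f μ := by
  have hmul {g : X → ℝ} (hg : Integrable g μ) : Integrable (fun x => h x * g x) μ :=
    hg.bdd_mul (c := 1) hh.aestronglyMeasurable (ae_of_all _ fun x => (habs x).le)
  refine ⟨fun hf => (hmul hf).congr (ae_of_all _ fun x => ?_), hmul⟩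
  simp only [← mul_assoc, ← abs_mul_abs_self (h x), habs, one_mul]

theorem exists_sign_integral_eq_integral_variation (μ : SignedMeasure X) :
    ∃ h : X → ℝ, Measurable h ∧ (∀ x, |h x| = 1) ∧
      ∀ f : X → ℝ, ∫ᵛ x, f x ∂•μ = ∫ x, h x * f x ∂μ.variation := by
  classical
  obtain ⟨S, hS, hpos, hneg⟩ := μ.toJordanDecomposition.mutuallySingular
  set p := μ.toJordanDecomposition.posPart
  set n := μ.toJordanDecomposition.negPart
  have hvar : μ.variation = p + n := μ.totalVariation_eq_variation.symm
  have hμ : μ = p.toSignedMeasure - n.toSignedMeasure :=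
    μ.toSignedMeasure_toJordanDecomposition.symm
  let h : X → ℝ := S.piecewise (fun _ => -1) fun _ => 1
  have hmeas : Measurable h := measurable_const.piecewise hS measurable_const
  have habs (x : X) : |h x| = 1 := by by_cases hx : x ∈ S <;> simp [h, hx]
  have hp : ∀ᵐ x ∂p, h x = 1 := by
    filter_upwards [measure_eq_zero_iff_ae_notMem.1 hpos] with x hx using by simp [h, hx]
  have hn : ∀ᵐ x ∂n, h x = -1 := by
    filter_upwards [measure_eq_zero_iff_ae_notMem.1 hneg] with x hx using by simp_all [h]
  refine ⟨h, hmeas, habs, fun f => ?_⟩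
  by_cases hf : Integrable f μ.variation
  · have hfp : Integrable f p := hf.mono_measure (hvar ▸ Measure.le_add_right le_rfl)
    have hfn : Integrable f n := hf.mono_measure (hvar ▸ Measure.le_add_left le_rfl)
    have ep : (fun x => h x * f x) =ᵐ[p] f := hp.mono fun x hx => by simp [hx]
    have en : (fun x => h x * f x) =ᵐ[n] fun x => -f x := hn.mono fun x hx => by simp [hx]
    rw [hvar, integral_add_measure (hfp.congr ep.symm) (hfn.neg.congr en.symm),
      integral_congr_ae ep, integral_congr_ae en, integral_neg, ← sub_eq_add_neg]
    conv_lhs => rw [hμ]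
    rw [VectorMeasure.integral_sub_vectorMeasure, integral_toSignedMeasure,
      integral_toSignedMeasure]
    · rwa [VectorMeasure.Integrable, Measure.variation_toSignedMeasure]
    · rwa [VectorMeasure.Integrable, Measure.variation_toSignedMeasure]
  · rw [VectorMeasure.integral_undef hf,
      integral_undef (mt (integrable_mul_iff_of_abs_eq_one hmeas habs).1 hf)]

theorem exists_sign_setIntegral_eq_setIntegral_variation (μ : SignedMeasure X) :
    ∃ h : X → ℝ, Measurable h ∧ (∀ x, |h x| = 1) ∧ ∀ (f : X → ℝ) {s : Set X}, MeasurableSet s →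
      ∫ᵛ x in s, f x ∂•μ = ∫ x in s, h x * f x ∂μ.variation := by
  obtain ⟨h, hmeas, habs, hint⟩ := exists_sign_integral_eq_integral_variation μ
  refine ⟨h, hmeas, habs, fun f s hs => ?_⟩
  rw [← VectorMeasure.integral_indicator hs, hint, ← integral_indicator hs]
  exact integral_congr_ae (ae_of_all _ fun x => (Set.indicator_mul_right s h f).symm)

theorem abs_setIntegral_vectorMeasure_le (μ : SignedMeasure X) (s : Set X) {f : X → ℝ} {C : ℝ}
    (hC0 : 0 ≤ C) (hC : ∀ x, |f x| ≤ C) :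
    |∫ᵛ x in s, f x ∂•μ| ≤ C * μ.variation.real Set.univ :=
  calc |∫ᵛ x in s, f x ∂•μ|
    _ = ‖∫ᵛ x in s, f x ∂•μ‖ := (Real.norm_eq_abs _).symm
    _ ≤ C * ‖(ContinuousLinearMap.lsmul ℝ ℝ : ℝ →L[ℝ] ℝ →L[ℝ] ℝ)‖ * μ.variation.real s :=
        VectorMeasure.norm_setIntegral_le_of_norm_le_const (f := f) fun x _ => hC x
    _ ≤ C * 1 * μ.variation.real Set.univ := by
      gcongr
      · exact ContinuousLinearMap.opNorm_lsmul_le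
      · exact measure_ne_top _ _
      · exact Set.subset_univ _
    _ = C * μ.variation.real Set.univ := by rw [mul_one]

theorem abs_setIntegral_sub_setIntegral_le {μ ν : SignedMeasure X} (s : Set X) {f g : X → ℝ}
    (hfμ : μ.Integrable f) (hgμ : μ.Integrable g) (hgν : ν.Integrable g) {C D : ℝ}
    (hC0 : 0 ≤ C) (hC : ∀ x, |f x - g x| ≤ C) (hD0 : 0 ≤ D) (hD : ∀ x, |g x| ≤ D) :
    |∫ᵛ x in s, f x ∂•μ - ∫ᵛ x in s, g x ∂•ν| ≤
      C * μ.variation.real Set.univ + D * (μ - ν).variation.real Set.univ := by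
  have hsplit : ∫ᵛ x in s, f x ∂•μ - ∫ᵛ x in s, g x ∂•ν =
      ∫ᵛ x in s, (f x - g x) ∂•μ + ∫ᵛ x in s, g x ∂•(μ - ν) := by
    rw [VectorMeasure.integral_fun_sub hfμ.restrict hgμ.restrict, VectorMeasure.restrict_sub,
      VectorMeasure.integral_sub_vectorMeasure hgμ.restrict hgν.restrict]
    ring
  rw [hsplit]
  exact (abs_add_le _ _).trans (add_le_add (abs_setIntegral_vectorMeasure_le μ s hC0 hC)
    (abs_setIntegral_vectorMeasure_le (μ - ν) s hD0 hD))

theorem variation_real_univ_le_add (μ ν : SignedMeasure X) :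
    μ.variation.real Set.univ ≤ ν.variation.real Set.univ + (μ - ν).variation.real Set.univ := by
  rw [← measureReal_add_apply]
  refine ENNReal.toReal_mono (measure_ne_top _ _) ?_
  simpa only [add_sub_cancel] using VectorMeasure.variation_add_le (μ := ν) (ν := μ - ν) Set.univ

end SignedMeasure

theorem continuous_setIntegral_Ioo (μ : SignedMeasure ℝ) [NullSingletonClass μ.variation]
    {f : ℝ → ℝ} (hf : μ.Integrable f) (a : ℝ) :
    Continuous fun t => ∫ᵛ s in Set.Ioo a t, f s ∂•μ := by
  obtain ⟨h, hmeas, habs, hint⟩ := exists_sign_setIntegral_eq_setIntegral_variation μ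
  have hhf : Integrable (fun s => h s * f s) μ.variation :=
    (integrable_mul_iff_of_abs_eq_one hmeas habs).2 hf
  have hprim (t : ℝ) : ∫ᵛ s in Set.Ioo a t, f s ∂•μ =
      ∫ s in a..max a t, h s * f s ∂μ.variation := by
    rw [hint f measurableSet_Ioo, intervalIntegral.integral_of_le (le_max_left a t),
      integral_Ioc_eq_integral_Ioo]
    rcases le_total a t with hat | hta
    · rw [max_eq_right hat]
    · simp only [max_eq_left hta, Set.Ioo_self, Set.Ioo_eq_empty hta.not_gt]
  simp_rw [hprim]
  exact (intervalIntegral.continuous_primitive (fun _ _ => hhf.intervalIntegrable) a).comp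
    (continuous_const.max continuous_id)

/-- Fubini on the square `(a, t)²`, cut along the diagonal: each of the two triangles gives one of
the two iterated integrals. -/
theorem setIntegral_mul_setIntegral_eq_add (p q : Measure ℝ) [SFinite p] [SFinite q]
    [NullSingletonClass p] {f g : ℝ → ℝ} {a t : ℝ} (hf : IntegrableOn f (Set.Ioo a t) p)
    (hg : IntegrableOn g (Set.Ioo a t) q) :
    (∫ s in Set.Ioo a t, f s ∂p) * (∫ s in Set.Ioo a t, g s ∂q) =
      (∫ s in Set.Ioo a t, f s * (∫ r in Set.Ioo a s, g r ∂q) ∂p) +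
      ∫ s in Set.Ioo a t, (∫ r in Set.Ioo a s, f r ∂p) * g s ∂q := by
  let D : Set (ℝ × ℝ) := {z | z.2 < z.1}
  have hD : MeasurableSet D := measurableSet_lt measurable_snd measurable_fst
  have hint : Integrable (fun z : ℝ × ℝ => f z.1 * g z.2)
      ((p.restrict (Set.Ioo a t)).prod (q.restrict (Set.Ioo a t))) := hf.mul_prod hg
  rw [← integral_prod_mul, ← integral_add_compl hD hint, ← integral_indicator hD,
    ← integral_indicator hD.compl, integral_prod _ (hint.indicator hD),
    integral_prod_symm _ (hint.indicator hD.compl)]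
  congr 1 <;> refine setIntegral_congr_fun measurableSet_Ioo fun s hs => ?_
  · have hslice : (fun r => D.indicator (fun z => f z.1 * g z.2) (s, r)) =
        (Set.Iio s).indicator fun r => f s * g r := by
      ext r; simp [D, Set.indicator_apply]
    rw [hslice, integral_indicator measurableSet_Iio, Measure.restrict_restrict measurableSet_Iio,
      Set.Iio_inter_Ioo, min_eq_left hs.2.le, integral_const_mul]
  · have hslice : (fun r => Dᶜ.indicator (fun z => f z.1 * g z.2) (r, s)) =
        (Set.Iic s).indicator fun r => f r * g s := by
      ext r; simp [D, Set.indicator_apply]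
    have hinter : Set.Iic s ∩ Set.Ioo a t = Set.Ioc a s := by
      ext r; exact ⟨fun h => ⟨h.2.1, h.1⟩, fun h => ⟨h.2, h.1, h.2.trans_lt hs.2⟩⟩
    rw [hslice, integral_indicator measurableSet_Iic, Measure.restrict_restrict measurableSet_Iic,
      hinter, integral_Ioc_eq_integral_Ioo, integral_mul_const]

theorem vectorMeasure_setIntegral_mul_setIntegral_eq_add (μ ν : SignedMeasure ℝ)
    [NullSingletonClass μ.variation] {f g : ℝ → ℝ} (hf : μ.Integrable f) (hg : ν.Integrable g)
    (a t : ℝ) :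
    (∫ᵛ s in Set.Ioo a t, f s ∂•μ) * (∫ᵛ s in Set.Ioo a t, g s ∂•ν) =
      (∫ᵛ s in Set.Ioo a t, f s * (∫ᵛ r in Set.Ioo a s, g r ∂•ν) ∂•μ) +
      ∫ᵛ s in Set.Ioo a t, (∫ᵛ r in Set.Ioo a s, f r ∂•μ) * g s ∂•ν := by
  obtain ⟨h, hmeas, habs, hμ⟩ := exists_sign_setIntegral_eq_setIntegral_variation μ
  obtain ⟨k, kmeas, kabs, hν⟩ := exists_sign_setIntegral_eq_setIntegral_variation ν
  have hhf : Integrable (fun s => h s * f s) μ.variation :=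
    (integrable_mul_iff_of_abs_eq_one hmeas habs).2 hf
  have hkg : Integrable (fun s => k s * g s) ν.variation :=
    (integrable_mul_iff_of_abs_eq_one kmeas kabs).2 hg
  simp only [hμ _ measurableSet_Ioo, hν _ measurableSet_Ioo]
  rw [setIntegral_mul_setIntegral_eq_add _ _ hhf.integrableOn hkg.integrableOn]
  simp only [mul_assoc, mul_left_comm]

/-! ### Stieltjes measures of continuous functions -/

section ContinuousBoundedVariation

variable {E : Type*} [NormedAddCommGroup E] [CompleteSpace E] {f g : ℝ → E}

theorem vectorMeasure_Ioc_of_continuous (hf : BoundedVariationOn f Set.univ) (hc : Continuous f)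
    {a b : ℝ} (h : a ≤ b) : hf.vectorMeasure (Set.Ioc a b) = f b - f a := by
  rw [hf.vectorMeasure_Ioc h, rightLim_eq_of_tendsto (hc.tendsto a |>.mono_left nhdsWithin_le_nhds),
    rightLim_eq_of_tendsto (hc.tendsto b |>.mono_left nhdsWithin_le_nhds)]

theorem nullSingletonClass_variation_vectorMeasure (hf : BoundedVariationOn f Set.univ)
    (hc : Continuous f) : NullSingletonClass hf.vectorMeasure.variation where
  measure_singleton a := by
    rw [VectorMeasure.variation_apply_eq_zero (measurableSet_singleton a)]
    intro s hs _
    rcases Set.subset_singleton_iff_eq.1 hs with rfl | rfl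
    · exact VectorMeasure.empty _
    · rw [hf.vectorMeasure_singleton,
        rightLim_eq_of_tendsto (hc.tendsto a |>.mono_left nhdsWithin_le_nhds),
        leftLim_eq_of_tendsto (hc.tendsto a |>.mono_left nhdsWithin_le_nhds), sub_self]

theorem vectorMeasure_Ioo_of_continuous (hf : BoundedVariationOn f Set.univ) (hc : Continuous f)
    {a b : ℝ} (h : a < b) : hf.vectorMeasure (Set.Ioo a b) = f b - f a := by
  rw [hf.vectorMeasure_Ioo h, rightLim_eq_of_tendsto (hc.tendsto a |>.mono_left nhdsWithin_le_nhds),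
    leftLim_eq_of_tendsto (hc.tendsto b |>.mono_left nhdsWithin_le_nhds)]

theorem vectorMeasure_sub_of_continuous (hf : BoundedVariationOn f Set.univ)
    (hg : BoundedVariationOn g Set.univ) (hfg : BoundedVariationOn (fun t => f t - g t) Set.univ)
    (hfc : Continuous f) (hgc : Continuous g) :
    hfg.vectorMeasure = hf.vectorMeasure - hg.vectorMeasure :=
  vectorMeasure_ext_of_Ioc fun a b hab => by
    rw [sub_apply, vectorMeasure_Ioc_of_continuous hf hfc hab,
      vectorMeasure_Ioc_of_continuous hg hgc hab,
      vectorMeasure_Ioc_of_continuous hfg (hfc.sub hgc) hab, sub_sub_sub_comm]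

theorem measure_stieltjesFunctionRightLim_Ioc (hf : BoundedVariationOn f Set.univ)
    (hc : Continuous f) {a b : ℝ} (hab : a ≤ b) :
    (hf.stieltjesFunctionRightLim 0).measure (Set.Ioc a b) = eVariationOn f (Set.Icc a b) := by
  have hr : f.rightLim = f :=
    funext fun t => rightLim_eq_of_tendsto (hc.tendsto t |>.mono_left nhdsWithin_le_nhds)
  have hfin : eVariationOn f (Set.Icc a b) ≠ ∞ := hf.mono (Set.subset_univ _)
  rw [StieltjesFunction.measure_Ioc, BoundedVariationOn.stieltjesFunctionRightLim_apply,
    BoundedVariationOn.stieltjesFunctionRightLim_apply, hr,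
    ← variationOnFromTo.add hf.locallyBoundedVariationOn (Set.mem_univ 0) (Set.mem_univ a)
      (Set.mem_univ b), add_sub_cancel_left, variationOnFromTo.eq_of_le _ _ hab, Set.univ_inter,
    ENNReal.ofReal_toReal hfin]

theorem variation_vectorMeasure_univ_le (hf : BoundedVariationOn f Set.univ) (hc : Continuous f) :
    hf.vectorMeasure.variation Set.univ ≤ eVariationOn f Set.univ := by
  let ν := (hf.stieltjesFunctionRightLim 0).measure
  have hν {a b : ℝ} (hab : a ≤ b) : ν (Set.Ioc a b) = eVariationOn f (Set.Icc a b) :=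
    measure_stieltjesFunctionRightLim_Ioc hf hc hab
  have huniv : ν Set.univ ≤ eVariationOn f Set.univ := by
    rw [← congrArg ν iUnion_Ioc_neg_natCast, monotone_Ioc_neg_natCast.measure_iUnion]
    refine iSup_le fun n => ?_
    rw [hν (by linarith [n.cast_nonneg (α := ℝ)])]
    exact eVariationOn.mono _ (Set.subset_univ _)
  have : IsFiniteMeasure ν := ⟨huniv.trans_lt hf.lt_top⟩
  refine (variation_le_of_forall_Ioc (ν := ν) (fun a b hab => ?_) _).trans huniv
  rw [vectorMeasure_Ioc_of_continuous hf hc hab, hν hab, ← edist_eq_enorm_sub]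
  exact eVariationOn.edist_le _ ⟨hab, le_rfl⟩ ⟨le_rfl, hab⟩

end ContinuousBoundedVariation

/-! ### The moment problem on an interval -/

section Moments

variable {h : ℝ → ℝ} {a b : ℝ}

theorem intervalIntegral_mul_eval_eq_zero (hab : a ≤ b) (hc : ContinuousOn h (Set.Icc a b))
    (hm : ∀ k : ℕ, ∫ s in a..b, h s * s ^ k = 0) (p : Polynomial ℝ) :
    ∫ s in a..b, h s * p.eval s = 0 := by
  have hint (q : Polynomial ℝ) : IntervalIntegrable (fun s => h s * q.eval s) volume a b :=
    (hc.mul q.continuousOn).intervalIntegrable_of_Icc hab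
  induction p using Polynomial.induction_on' with
  | add p q hp hq =>
    simp_rw [Polynomial.eval_add, mul_add]
    rw [intervalIntegral.integral_add (hint p) (hint q), hp, hq, add_zero]
  | monomial k c =>
    simp_rw [Polynomial.eval_monomial, mul_left_comm]
    rw [intervalIntegral.integral_const_mul, hm, mul_zero]

theorem eqOn_zero_of_forall_integral_mul_pow_eq_zero (hab : a < b)
    (hc : ContinuousOn h (Set.Icc a b)) (hm : ∀ k : ℕ, ∫ s in a..b, h s * s ^ k = 0) :
    Set.EqOn h 0 (Set.Icc a b) := by
  have hint {v : ℝ → ℝ} (hv : ContinuousOn v (Set.Icc a b)) :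
      IntervalIntegrable (fun s => h s * v s) volume a b :=
    (hc.mul hv).intervalIntegrable_of_Icc hab.le
  have hsq_le (ε : ℝ) (hε : 0 < ε) : ∫ s in a..b, h s * h s ≤ (∫ s in a..b, |h s|) * ε := by
    obtain ⟨p, hp⟩ := exists_polynomial_near_of_continuousOn a b h hc ε hε
    calc ∫ s in a..b, h s * h s
      _ = ∫ s in a..b, h s * (h s - p.eval s) := by
        simp_rw [mul_sub]
        rw [intervalIntegral.integral_sub (hint hc) (hint p.continuousOn),
          intervalIntegral_mul_eval_eq_zero hab.le hc hm, sub_zero]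
      _ ≤ ∫ s in a..b, |h s| * ε := by
        refine intervalIntegral.integral_mono_on hab.le (hint (hc.sub p.continuousOn))
          ((hc.abs.mul continuousOn_const).intervalIntegrable_of_Icc hab.le)
          fun s hs => (le_abs_self _).trans ?_
        rw [abs_mul, abs_sub_comm]
        exact mul_le_mul_of_nonneg_left (hp s hs).le (abs_nonneg _)
      _ = (∫ s in a..b, |h s|) * ε := intervalIntegral.integral_mul_const _ _
  have hlim : Tendsto (fun ε : ℝ => (∫ s in a..b, |h s|) * ε) (𝓝[>] 0) (𝓝 0) :=
    ((continuous_const_mul (∫ s in a..b, |h s|)).tendsto' 0 0 (mul_zero _)).mono_left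
      nhdsWithin_le_nhds
  have hsq_nonpos : ∫ s in a..b, h s * h s ≤ 0 :=
    ge_of_tendsto hlim (eventually_mem_nhdsWithin.mono hsq_le)
  intro t ht
  by_contra hne
  exact hsq_nonpos.not_gt (intervalIntegral.integral_pos hab (hc.mul hc)
    (fun s _ => mul_self_nonneg _) ⟨t, ht, mul_self_pos.2 hne⟩)

end Moments

/-! ### Continuity of the signature -/

namespace BVPath

variable {n : ℕ}

theorem continuous_stopped (x : BVPath n) : Continuous x.stopped :=
  x.toFun.continuous.Icc_extend'

theorem continuous_coord (x : BVPath n) (i : Fin n) : Continuous fun t => x.stopped t i :=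
  (EuclideanSpace.proj (𝕜 := ℝ) i).continuous.comp x.continuous_stopped

theorem eq_of_stopped_eq {x y : BVPath n} (hT : x.T = y.T)
    (h : ∀ t ∈ Set.Icc 0 x.T, x.stopped t = y.stopped t) : x = y := by
  obtain ⟨T, hT0, f, hf, hf0⟩ := x
  obtain ⟨T', hT0', g, hg, hg0⟩ := y
  obtain rfl : T = T' := hT
  obtain rfl : f = g := by
    ext1 t
    simpa only [stopped, Set.IccExtend_of_mem _ _ t.2] using h t t.2
  rfl

theorem dist_def (x y : BVPath n) : dist x y = |x.T - y.T| +
    (eVariationOn (fun t => x.stopped t - y.stopped t) Set.univ).toReal := rfl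

theorem continuous_T : Continuous (T : BVPath n → ℝ) :=
  (LipschitzWith.of_dist_le_mul (K := 1) fun x y => by
    rw [NNReal.coe_one, one_mul, dist_def]
    exact le_add_of_nonneg_right ENNReal.toReal_nonneg).continuous

/-- The signed Stieltjes measure `dxⁱ` of the `i`-th coordinate of the stopped path, against which
the iterated integrals are taken. -/
noncomputable abbrev coordMeasure (x : BVPath n) (i : Fin n) : SignedMeasure ℝ :=
  (x.coord_boundedVariation i).vectorMeasure

instance nullSingletonClass_variation_coordMeasure (x : BVPath n) (i : Fin n) :
    NullSingletonClass (x.coordMeasure i).variation :=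
  nullSingletonClass_variation_vectorMeasure _ (x.continuous_coord i)

theorem variation_coordMeasure_sub_le (x y : BVPath n) (i : Fin n) :
    (x.coordMeasure i - y.coordMeasure i).variation.real Set.univ ≤ dist x y := by
  have hle : eVariationOn (fun t => x.stopped t i - y.stopped t i) Set.univ ≤
      eVariationOn (fun t => x.stopped t - y.stopped t) Set.univ :=
    iSup_mono fun p => Finset.sum_le_sum fun k _ => PiLp.edist_apply_le (p := 2)
      (x.stopped (p.2.1 (k + 1)) - y.stopped (p.2.1 (k + 1)))
      (x.stopped (p.2.1 k) - y.stopped (p.2.1 k)) i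
  have hbv : BoundedVariationOn (fun t => x.stopped t i - y.stopped t i) Set.univ :=
    ne_top_of_le_ne_top (sub_boundedVariation x y) hle
  have hcx := x.continuous_coord i
  have hcy := y.continuous_coord i
  have hvar := variation_vectorMeasure_univ_le hbv (hcx.sub hcy)
  rw [vectorMeasure_sub_of_continuous (x.coord_boundedVariation i) (y.coord_boundedVariation i) hbv
    hcx hcy] at hvar
  rw [dist_def]
  exact le_add_of_nonneg_of_le (abs_nonneg _)
    (ENNReal.toReal_mono (sub_boundedVariation x y) (hvar.trans hle))

theorem iteratedIntegral_zero (x : BVPath n) (I : Fin 0 → Fin n) (t : ℝ) :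
    x.iteratedIntegral 0 I t = 1 := rfl

theorem iteratedIntegral_succ (x : BVPath n) {m : ℕ} (I : Fin (m + 1) → Fin n) (t : ℝ) :
    x.iteratedIntegral (m + 1) I t =
      ∫ᵛ s in Set.Ioo 0 t, x.iteratedIntegral m (Fin.init I) s ∂•x.coordMeasure (I (Fin.last m)) :=
  rfl

theorem iteratedIntegral_snoc (x : BVPath n) {m : ℕ} (I : Fin m → Fin n) (i : Fin n) (t : ℝ) :
    x.iteratedIntegral (m + 1) (Fin.snoc I i : Fin (m + 1) → Fin n) t =
      ∫ᵛ s in Set.Ioo 0 t, x.iteratedIntegral m I s ∂•x.coordMeasure i := by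
  rw [iteratedIntegral_succ, Fin.init_snoc, Fin.snoc_last]

theorem iteratedIntegral_one (x : BVPath n) (I : Fin 1 → Fin n) {t : ℝ} (ht : 0 < t) :
    x.iteratedIntegral 1 I t = x.stopped t (I 0) := by
  simp only [iteratedIntegral_succ, iteratedIntegral_zero]
  rw [VectorMeasure.setIntegral_const, Fin.last_zero, coordMeasure,
    vectorMeasure_Ioo_of_continuous _ (x.continuous_coord _) ht, stopped_zero]
  simp

theorem exists_abs_iteratedIntegral_le (x : BVPath n) {m : ℕ} (I : Fin m → Fin n) :
    ∃ C, 0 ≤ C ∧ ∀ t, |x.iteratedIntegral m I t| ≤ C := by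
  induction m with
  | zero => exact ⟨1, zero_le_one, fun t => abs_one.le⟩
  | succ m ih =>
    obtain ⟨C, hC0, hC⟩ := ih (Fin.init I)
    exact ⟨_, mul_nonneg hC0 measureReal_nonneg, fun t =>
      abs_setIntegral_vectorMeasure_le (x.coordMeasure (I (Fin.last m))) _ hC0 hC⟩

theorem integrable_iteratedIntegral_of_continuous (x : BVPath n) {m : ℕ} {I : Fin m → Fin n}
    (hc : Continuous (x.iteratedIntegral m I)) (μ : SignedMeasure ℝ) :
    μ.Integrable (x.iteratedIntegral m I) := by
  obtain ⟨C, -, hC⟩ := x.exists_abs_iteratedIntegral_le I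
  exact Integrable.of_bound (μ := μ.variation) hc.aestronglyMeasurable C (ae_of_all _ hC)

theorem continuous_iteratedIntegral (x : BVPath n) {m : ℕ} (I : Fin m → Fin n) :
    Continuous (x.iteratedIntegral m I) := by
  induction m with
  | zero => exact continuous_const
  | succ m ih =>
    exact continuous_setIntegral_Ioo _
      (x.integrable_iteratedIntegral_of_continuous (ih (Fin.init I)) _) 0

theorem integrable_iteratedIntegral (x : BVPath n) {m : ℕ} (I : Fin m → Fin n)
    (μ : SignedMeasure ℝ) : μ.Integrable (x.iteratedIntegral m I) :=
  x.integrable_iteratedIntegral_of_continuous (x.continuous_iteratedIntegral I) μ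

theorem exists_abs_iteratedIntegral_sub_le_mul_dist (y : BVPath n) {m : ℕ} (I : Fin m → Fin n) :
    ∃ L, 0 ≤ L ∧ ∀ x : BVPath n, dist x y ≤ 1 → ∀ t,
      |x.iteratedIntegral m I t - y.iteratedIntegral m I t| ≤ L * dist x y := by
  induction m with
  | zero => exact ⟨0, le_rfl, fun x _ t => by simp [iteratedIntegral_zero]⟩
  | succ m ih =>
    obtain ⟨L, hL0, hL⟩ := ih (Fin.init I)
    obtain ⟨C, hC0, hC⟩ := y.exists_abs_iteratedIntegral_le (Fin.init I)
    set i := I (Fin.last m)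
    set V := (y.coordMeasure i).variation.real Set.univ
    have : 0 ≤ V := measureReal_nonneg
    refine ⟨L * (V + 1) + C, by positivity, fun x hxy t => ?_⟩
    have hvar : (x.coordMeasure i).variation.real Set.univ ≤ V + 1 :=
      (variation_real_univ_le_add _ (y.coordMeasure i)).trans (by
        gcongr
        exact (variation_coordMeasure_sub_le x y i).trans hxy)
    calc |x.iteratedIntegral (m + 1) I t - y.iteratedIntegral (m + 1) I t|
      _ ≤ L * dist x y * (x.coordMeasure i).variation.real Set.univ +
          C * (x.coordMeasure i - y.coordMeasure i).variation.real Set.univ :=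
        abs_setIntegral_sub_setIntegral_le _ (x.integrable_iteratedIntegral _ _)
          (y.integrable_iteratedIntegral _ _) (y.integrable_iteratedIntegral _ _) (by positivity)
          (hL x hxy) hC0 hC
      _ ≤ L * dist x y * (V + 1) + C * dist x y := by
        gcongr
        exact variation_coordMeasure_sub_le x y i
      _ = (L * (V + 1) + C) * dist x y := by ring

theorem continuous_signature_apply {m : ℕ} (I : Fin m → Fin n) :
    Continuous fun x : BVPath n => x.signature m I := by
  refine continuous_iff_continuousAt.2 fun y => ?_
  obtain ⟨L, -, hL⟩ := y.exists_abs_iteratedIntegral_sub_le_mul_dist I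
  have hdist : Tendsto (fun x : BVPath n => L * dist x y) (𝓝 y) (𝓝 0) :=
    (continuous_const.mul (continuous_id.dist continuous_const)).tendsto' _ _ (by simp)
  have hsub : Tendsto (fun x : BVPath n => x.iteratedIntegral m I x.T - y.iteratedIntegral m I x.T)
      (𝓝 y) (𝓝 0) := by
    refine squeeze_zero_norm' ?_ hdist
    filter_upwards [Metric.closedBall_mem_nhds y one_pos] with x hx using hL x hx x.T
  simpa only [ContinuousAt, signature, Function.comp_apply, sub_add_cancel, zero_add] using
    hsub.add (((y.continuous_iteratedIntegral I).comp continuous_T).tendsto y)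

theorem continuous_signature (m : ℕ) : Continuous fun x : BVPath n => x.signature m :=
  continuous_pi fun I => continuous_signature_apply I

/-! ### The algebra of linear functionals of the signature -/

/-- The linear span of the iterated integrals, as functions of the path and of the end time. -/
noncomputable def iteratedIntegralSpan (n : ℕ) : Submodule ℝ (BVPath n → ℝ → ℝ) :=
  Submodule.span ℝ (Set.range fun (I : Σ m : ℕ, (Fin m → Fin n)) (x : BVPath n) (t : ℝ) =>
    x.iteratedIntegral I.1 I.2 t)

theorem iteratedIntegral_mem_span {m : ℕ} (I : Fin m → Fin n) :
    (fun (x : BVPath n) (t : ℝ) => x.iteratedIntegral m I t) ∈ iteratedIntegralSpan n :=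
  Submodule.subset_span ⟨⟨m, I⟩, rfl⟩

theorem integrable_of_mem_span {φ : BVPath n → ℝ → ℝ} (hφ : φ ∈ iteratedIntegralSpan n)
    (x : BVPath n) (μ : SignedMeasure ℝ) : μ.Integrable (φ x) := by
  induction hφ using Submodule.span_induction with
  | mem φ h =>
    obtain ⟨I, rfl⟩ := h
    exact x.integrable_iteratedIntegral I.2 μ
  | zero => exact integrable_zero _ _ _
  | add φ ψ _ _ hφ hψ => exact Integrable.add hφ hψ
  | smul c φ _ hφ => exact Integrable.smul c hφ

theorem setIntegral_mem_span {φ : BVPath n → ℝ → ℝ} (hφ : φ ∈ iteratedIntegralSpan n)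
    (i : Fin n) :
    (fun (x : BVPath n) (t : ℝ) => ∫ᵛ s in Set.Ioo 0 t, φ x s ∂•x.coordMeasure i) ∈
      iteratedIntegralSpan n := by
  induction hφ using Submodule.span_induction with
  | mem φ h =>
    obtain ⟨⟨m, I⟩, rfl⟩ := h
    simpa only [iteratedIntegral_snoc] using
      iteratedIntegral_mem_span (Fin.snoc I i : Fin (m + 1) → Fin n)
  | zero =>
    convert (iteratedIntegralSpan n).zero_mem using 1
    ext x t
    exact VectorMeasure.integral_zero
  | add φ ψ hφ hψ ihφ ihψ =>
    convert (iteratedIntegralSpan n).add_mem ihφ ihψ using 1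
    ext x t
    exact VectorMeasure.integral_fun_add (integrable_of_mem_span hφ x _).restrict
      (integrable_of_mem_span hψ x _).restrict
  | smul c φ _ ihφ =>
    convert (iteratedIntegralSpan n).smul_mem c ihφ using 1
    ext x t
    exact VectorMeasure.integral_fun_smul _ _ c (φ x)

/-- Integration by parts is the recursion for the shuffle product: it removes the last letter of
one of the two words. -/
theorem iteratedIntegral_mul_mem_span : ∀ {m k : ℕ} (I : Fin m → Fin n) (J : Fin k → Fin n),
    (fun (x : BVPath n) (t : ℝ) => x.iteratedIntegral m I t * x.iteratedIntegral k J t) ∈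
      iteratedIntegralSpan n
  | 0, _, _, J => by
    simpa only [iteratedIntegral_zero, one_mul] using iteratedIntegral_mem_span J
  | _, 0, I, _ => by
    simpa only [iteratedIntegral_zero, mul_one] using iteratedIntegral_mem_span I
  | m + 1, k + 1, I, J => by
    have hI := setIntegral_mem_span (iteratedIntegral_mul_mem_span (Fin.init I) J) (I (Fin.last m))
    have hJ := setIntegral_mem_span (iteratedIntegral_mul_mem_span I (Fin.init J)) (J (Fin.last k))
    convert (iteratedIntegralSpan n).add_mem hI hJ using 1
    ext x t
    exact vectorMeasure_setIntegral_mul_setIntegral_eq_add _ _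
      (x.integrable_iteratedIntegral _ _) (x.integrable_iteratedIntegral _ _) 0 t
  termination_by m k => m + k

/-- The span of the iterated integrals as an algebra: by the shuffle identity it is closed under
pointwise products. -/
noncomputable def iteratedIntegralAlgebra (n : ℕ) : Subalgebra ℝ (BVPath n → ℝ → ℝ) :=
  (iteratedIntegralSpan n).toSubalgebra (iteratedIntegral_mem_span Fin.elim0) fun φ ψ hφ hψ => by
    have hmul := Submodule.mul_mem_mul hφ hψ
    rw [iteratedIntegralSpan, Submodule.span_mul_span] at hmul
    refine Submodule.span_le.2 ?_ hmul
    rintro _ ⟨_, ⟨I, rfl⟩, _, ⟨J, rfl⟩, rfl⟩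
    exact iteratedIntegral_mul_mem_span I.2 J.2

theorem iteratedIntegral_mem_algebra {m : ℕ} (I : Fin m → Fin n) :
    (fun (x : BVPath n) (t : ℝ) => x.iteratedIntegral m I t) ∈ iteratedIntegralAlgebra n :=
  iteratedIntegral_mem_span I

theorem setIntegral_mem_algebra {φ : BVPath n → ℝ → ℝ} (hφ : φ ∈ iteratedIntegralAlgebra n)
    (i : Fin n) :
    (fun (x : BVPath n) (t : ℝ) => ∫ᵛ s in Set.Ioo 0 t, φ x s ∂•x.coordMeasure i) ∈
      iteratedIntegralAlgebra n :=
  setIntegral_mem_span hφ i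

theorem exists_pairing_eq_of_mem_algebra {φ : BVPath n → ℝ → ℝ}
    (hφ : φ ∈ iteratedIntegralAlgebra n) :
    ∃ w : (Σ m : ℕ, (Fin m → Fin n)) →₀ ℝ, ∀ x, pairing w x = φ x x.T := by
  obtain ⟨w, rfl⟩ := Finsupp.mem_span_range_iff_exists_finsupp.1 hφ
  refine ⟨w, fun x => ?_⟩
  simp only [pairing, Finsupp.sum, Finset.sum_apply, Pi.smul_apply, smul_eq_mul, signature]

theorem eval_eq_of_signature_eq {x y : BVPath n} (h : x.signature = y.signature)
    {φ : BVPath n → ℝ → ℝ} (hφ : φ ∈ iteratedIntegralAlgebra n) : φ x x.T = φ y y.T := by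
  obtain ⟨w, hw⟩ := exists_pairing_eq_of_mem_algebra hφ
  rw [← hw, ← hw]
  simp only [pairing, h]

end BVPath

/-! ### Time-augmented paths -/

theorem eVariationOn_le_of_monotoneOn {α : Type*} [LinearOrder α] {f : α → ℝ} {s : Set α} {a b : ℝ}
    (hf : MonotoneOn f s) (hs : Set.MapsTo f s (Set.Icc a b)) :
    eVariationOn f s ≤ ENNReal.ofReal (b - a) := by
  rcases s.eq_empty_or_nonempty with rfl | ⟨t, ht⟩
  · rw [eVariationOn.subsingleton _ Set.subsingleton_empty]
    exact zero_le
  have hab : a ≤ b := (hs ht).1.trans (hs ht).2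
  calc eVariationOn f s
    _ ≤ eVariationOn id (Set.Icc a b) := eVariationOn.comp_le_of_monotoneOn id f hf hs
    _ = ENNReal.ofReal (b - a) := by
      simpa only [Set.inter_self, id] using (monotone_id.monotoneOn _).eVariationOn_eq
        (Set.left_mem_Icc.2 hab) (Set.right_mem_Icc.2 hab)

theorem eVariationOn_clamp_sub_clamp_le (S T : ℝ) (s : Set ℝ) :
    eVariationOn (fun t => max 0 (min S t) - max 0 (min T t)) s ≤ ENNReal.ofReal |S - T| := by
  wlog hTS : T ≤ S generalizing S T
  · rw [abs_sub_comm]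
    refine le_trans (iSup_mono fun p => Finset.sum_le_sum fun k _ => ?_)
      (this T S (le_of_not_ge hTS))
    rw [← edist_neg_neg, neg_sub, neg_sub]
  rw [abs_of_nonneg (sub_nonneg.2 hTS), ← sub_zero (S - T)]
  exact eVariationOn_le_of_monotoneOn (fun a _ b _ hab => by grind) fun t _ => ⟨by grind, by grind⟩

theorem edist_le_edist_zero_add_edist_succ {n : ℕ} {u v : EuclideanSpace ℝ (Fin (n + 1))}
    {u' v' : EuclideanSpace ℝ (Fin n)} (hu : ∀ j, u j.succ = u' j) (hv : ∀ j, v j.succ = v' j) :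
    edist u v ≤ edist (u 0) (v 0) + edist u' v' := by
  rw [edist_dist, edist_dist, edist_dist, ← ENNReal.ofReal_add dist_nonneg dist_nonneg,
    EuclideanSpace.dist_eq u, Fin.sum_univ_succ]
  simp only [hu, hv]
  refine ENNReal.ofReal_le_ofReal (Real.sqrt_le_iff.2 ⟨by positivity, ?_⟩)
  rw [← EuclideanSpace.dist_sq_eq]
  nlinarith [dist_nonneg (x := u 0) (y := v 0), dist_nonneg (x := u') (y := v')]

namespace BVPath

variable {n : ℕ}

theorem timeAugment_T (x : BVPath n) : x.timeAugment.T = x.T := rfl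

theorem stopped_timeAugment_zero (x : BVPath n) (t : ℝ) :
    x.timeAugment.stopped t 0 = max 0 (min x.T t) := rfl

theorem stopped_timeAugment_succ (x : BVPath n) (t : ℝ) (j : Fin n) :
    x.timeAugment.stopped t j.succ = x.stopped t j := rfl

theorem dist_timeAugment_le (x y : BVPath n) :
    dist x.timeAugment y.timeAugment ≤ 2 * dist x y := by
  have hvar : eVariationOn (fun t => x.timeAugment.stopped t - y.timeAugment.stopped t) Set.univ ≤
      ENNReal.ofReal |x.T - y.T| +
        eVariationOn (fun t => x.stopped t - y.stopped t) Set.univ := by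
    refine (eVariationOn_le_add_of_edist_le fun a b => ?_).trans
      (add_le_add_left (eVariationOn_clamp_sub_clamp_le x.T y.T Set.univ) _)
    exact edist_le_edist_zero_add_edist_succ (fun j => rfl) fun j => rfl
  have hfin := sub_boundedVariation x y
  have hreal := ENNReal.toReal_mono (ENNReal.add_ne_top.2 ⟨ENNReal.ofReal_ne_top, hfin⟩) hvar
  rw [ENNReal.toReal_add ENNReal.ofReal_ne_top hfin, ENNReal.toReal_ofReal (abs_nonneg _)] at hreal
  rw [dist_def, dist_def x, timeAugment_T, timeAugment_T]
  linarith [ENNReal.toReal_nonneg (a := eVariationOn (fun t => x.stopped t - y.stopped t) Set.univ)]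

theorem continuous_timeAugment : Continuous (timeAugment : BVPath n → BVPath (n + 1)) :=
  (LipschitzWith.of_dist_le_mul (K := 2) dist_timeAugment_le).continuous

theorem continuous_augmentOn (K : Set (BVPath n)) : Continuous (augmentOn K) :=
  (continuous_timeAugment.comp continuous_subtype_val).subtype_mk _

theorem coordMeasure_timeAugment_zero (x : BVPath n) :
    x.timeAugment.coordMeasure 0 = (volume.restrict (Set.Ioc 0 x.T)).toSignedMeasure :=
  vectorMeasure_ext_of_Ioc fun a b hab => by
    have hT := x.T_pos
    rw [coordMeasure, vectorMeasure_Ioc_of_continuous _ (x.timeAugment.continuous_coord 0) hab,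
      stopped_timeAugment_zero, stopped_timeAugment_zero,
      Measure.toSignedMeasure_apply_measurable measurableSet_Ioc,
      measureReal_restrict_apply measurableSet_Ioc, Set.Ioc_inter_Ioc, measureReal_def,
      Real.volume_Ioc, ENNReal.toReal_ofReal']
    grind

theorem setIntegral_coordMeasure_timeAugment_zero (x : BVPath n) (f : ℝ → ℝ) :
    ∫ᵛ s in Set.Ioo 0 x.T, f s ∂•x.timeAugment.coordMeasure 0 = ∫ s in (0 : ℝ)..x.T, f s := by
  rw [coordMeasure_timeAugment_zero, ← VectorMeasure.integral_indicator measurableSet_Ioo,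
    integral_toSignedMeasure, integral_indicator measurableSet_Ioo,
    Measure.restrict_restrict measurableSet_Ioo, Set.inter_eq_left.2 Set.Ioo_subset_Ioc_self,
    intervalIntegral.integral_of_le x.T_pos.le, integral_Ioc_eq_integral_Ioo]

theorem iteratedIntegral_timeAugment_end (x : BVPath n) :
    x.timeAugment.iteratedIntegral 1 (fun _ => 0) x.timeAugment.T = x.T := by
  rw [timeAugment_T, iteratedIntegral_one _ _ x.T_pos, stopped_timeAugment_zero, min_self,
    max_eq_right x.T_pos.le]

theorem exists_mem_algebra_eq_moment (j : Fin n) (k : ℕ) :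
    ∃ φ ∈ iteratedIntegralAlgebra (n + 1), ∀ x : BVPath n,
      φ x.timeAugment x.timeAugment.T = ∫ s in (0 : ℝ)..x.T, x.stopped s j * s ^ k := by
  refine ⟨_, setIntegral_mem_algebra (mul_mem (iteratedIntegral_mem_algebra fun _ : Fin 1 => j.succ)
    (pow_mem (iteratedIntegral_mem_algebra fun _ : Fin 1 => 0) k)) 0, fun x => ?_⟩
  simp only [timeAugment_T]
  rw [setIntegral_coordMeasure_timeAugment_zero, intervalIntegral.integral_of_le x.T_pos.le,
    intervalIntegral.integral_of_le x.T_pos.le]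
  refine setIntegral_congr_fun measurableSet_Ioc fun s hs => ?_
  simp only [Pi.mul_apply, Pi.pow_apply]
  rw [iteratedIntegral_one _ _ hs.1, iteratedIntegral_one _ _ hs.1, stopped_timeAugment_zero,
    stopped_timeAugment_succ, min_eq_right hs.2, max_eq_right hs.1.le]

theorem injective_signature_timeAugment :
    Function.Injective fun x : BVPath n => x.timeAugment.signature := by
  intro x y hxy
  have hsig : x.timeAugment.signature = y.timeAugment.signature := hxy
  have hT : x.T = y.T := by
    have heval := eval_eq_of_signature_eq hsig (iteratedIntegral_mem_algebra fun _ : Fin 1 => 0)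
    rwa [iteratedIntegral_timeAugment_end, iteratedIntegral_timeAugment_end] at heval
  refine eq_of_stopped_eq hT fun t ht => ?_
  ext j
  have hint (z : BVPath n) (k : ℕ) :
      IntervalIntegrable (fun s => z.stopped s j * s ^ k) volume 0 x.T :=
    ((z.continuous_coord j).mul (continuous_pow k)).intervalIntegrable _ _
  have hmoment (k : ℕ) : ∫ s in (0 : ℝ)..x.T, (x.stopped s j - y.stopped s j) * s ^ k = 0 := by
    obtain ⟨φ, hφ, hφ_eq⟩ := exists_mem_algebra_eq_moment j k
    have heval := eval_eq_of_signature_eq hsig hφ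
    rw [hφ_eq, hφ_eq, ← hT] at heval
    simp_rw [sub_mul]
    rw [intervalIntegral.integral_sub (hint x k) (hint y k), heval, sub_self]
  exact sub_eq_zero.1 (eqOn_zero_of_forall_integral_mul_pow_eq_zero x.T_pos
    ((x.continuous_coord j).sub (y.continuous_coord j)).continuousOn hmoment ht)

/-! ### Measures on a compact set of paths -/

section LinearFunctionals

variable {L : Set (BVPath n)}

/-- The bounded continuous functions on a set of paths that are linear functionals of the
signature. The trivial star is part of the structure because separation of measures is stated for
star subalgebras. -/
noncomputable def signatureAlgebra (L : Set (BVPath n)) : StarSubalgebra ℝ (L →ᵇ ℝ) where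
  carrier := {g | ∃ φ ∈ iteratedIntegralAlgebra n, ∀ x : L, g x = φ x (x : BVPath n).T}
  mul_mem' := by
    rintro g h ⟨φ, hφ, hg⟩ ⟨ψ, hψ, hh⟩
    exact ⟨φ * ψ, mul_mem hφ hψ, fun x => congrArg₂ (· * ·) (hg x) (hh x)⟩
  add_mem' := by
    rintro g h ⟨φ, hφ, hg⟩ ⟨ψ, hψ, hh⟩
    exact ⟨φ + ψ, add_mem hφ hψ, fun x => congrArg₂ (· + ·) (hg x) (hh x)⟩
  algebraMap_mem' c := ⟨algebraMap ℝ _ c, algebraMap_mem _ c, fun x => rfl⟩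
  star_mem' := by
    rintro g ⟨φ, hφ, hg⟩
    exact ⟨φ, hφ, fun x => hg x⟩

theorem exists_eq_pairing_of_mem_signatureAlgebra {g : L →ᵇ ℝ} (hg : g ∈ signatureAlgebra L) :
    ∃ w : (Σ m : ℕ, (Fin m → Fin n)) →₀ ℝ, ∀ x : L, g x = pairing w (x : BVPath n) := by
  obtain ⟨φ, hφ, hg_eq⟩ := hg
  obtain ⟨w, hw⟩ := exists_pairing_eq_of_mem_algebra hφ
  exact ⟨w, fun x => (hg_eq x).trans (hw x).symm⟩

variable [CompactSpace L]

theorem separatesPoints_signatureAlgebra (hL : Set.InjOn signature L) :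
    ((signatureAlgebra L).map
      (BoundedContinuousFunction.toContinuousMapStarₐ ℝ)).SeparatesPoints := by
  intro x y hxy
  obtain ⟨m, hm⟩ := Function.ne_iff.1 fun h => hxy (Subtype.ext (hL x.2 y.2 h))
  obtain ⟨I, hI⟩ := Function.ne_iff.1 hm
  let g : L →ᵇ ℝ := BoundedContinuousFunction.mkOfCompact
    ⟨fun z : L => (z : BVPath n).signature m I,
      (continuous_signature_apply I).comp continuous_subtype_val⟩
  have hg : g ∈ signatureAlgebra L := ⟨_, iteratedIntegral_mem_algebra I, fun _ => rfl⟩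
  exact ⟨g, ⟨_, ⟨g, hg, rfl⟩, rfl⟩, hI⟩

theorem exists_forall_abs_sub_pairing_lt (hL : Set.InjOn signature L) (f : L →ᵇ ℝ) {ε : ℝ}
    (hε : 0 < ε) :
    ∃ w : (Σ m : ℕ, (Fin m → Fin n)) →₀ ℝ, ∀ x : L, |f x - pairing w (x : BVPath n)| < ε := by
  obtain ⟨⟨_, g, hg, rfl⟩, hnear⟩ :=
    ContinuousMap.exists_mem_subalgebra_near_continuous_of_separatesPoints _
      (separatesPoints_signatureAlgebra hL) f f.continuous ε hε
  obtain ⟨w, hw⟩ := exists_eq_pairing_of_mem_signatureAlgebra hg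
  refine ⟨w, fun x => ?_⟩
  rw [← hw, abs_sub_comm]
  exact hnear x

theorem integrable_signature (μ : Measure L) [IsFiniteMeasure μ] (m : ℕ) :
    Integrable (fun x : L => (x : BVPath n).signature m) μ :=
  ((continuous_signature m).comp continuous_subtype_val).integrable_of_hasCompactSupport
    (HasCompactSupport.of_compactSpace _)

theorem integral_pairing (μ : Measure L) [IsFiniteMeasure μ]
    (w : (Σ m : ℕ, (Fin m → Fin n)) →₀ ℝ) :
    ∫ x : L, pairing w (x : BVPath n) ∂μ =
      w.sum fun I c => c * (∫ x : L, (x : BVPath n).signature I.1 ∂μ) I.2 := by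
  have hint (I : Σ m : ℕ, (Fin m → Fin n)) := (integrable_signature μ I.1).eval
  simp only [pairing, Finsupp.sum]
  rw [integral_finsetSum _ fun I _ => (hint I I.2).const_mul _]
  exact Finset.sum_congr rfl fun I _ => by rw [integral_const_mul, eval_integral (hint I)]

theorem measure_eq_of_integral_signature_eq (hL : Set.InjOn signature L) {μ ν : Measure L}
    [IsFiniteMeasure μ] [IsFiniteMeasure ν]
    (h : ∀ m, ∫ x : L, (x : BVPath n).signature m ∂μ = ∫ x : L, (x : BVPath n).signature m ∂ν) :
    μ = ν := by
  refine ext_of_forall_mem_subalgebra_integral_eq_of_pseudoEMetric_complete_countable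
    (separatesPoints_signatureAlgebra hL) fun g hg => ?_
  obtain ⟨w, hw⟩ := exists_eq_pairing_of_mem_signatureAlgebra hg
  simp only [hw, integral_pairing, h]

theorem tendsto_iff_tendsto_integral_signature (hL : Set.InjOn signature L) {ι : Type*}
    {l : Filter ι} {μ : ι → ProbabilityMeasure L} {ν : ProbabilityMeasure L} :
    Tendsto μ l (𝓝 ν) ↔ ∀ m, Tendsto (fun k => ∫ x : L, (x : BVPath n).signature m ∂(μ k)) l
      (𝓝 (∫ x : L, (x : BVPath n).signature m ∂ν)) := by
  refine ⟨fun h m => tendsto_pi_nhds.2 fun I => ?_, fun h => ?_⟩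
  · simp only [eval_integral (integrable_signature _ m).eval]
    exact ProbabilityMeasure.tendsto_iff_forall_integral_tendsto.1 h
      (BoundedContinuousFunction.mkOfCompact ⟨fun x : L => (x : BVPath n).signature m I,
        (continuous_signature_apply I).comp continuous_subtype_val⟩)
  · refine ProbabilityMeasure.tendsto_of_tight_of_separatesPoints ℝ
      IsTightMeasureSet.of_compactSpace (separatesPoints_signatureAlgebra hL) fun g hg => ?_
    obtain ⟨w, hw⟩ := exists_eq_pairing_of_mem_signatureAlgebra hg
    simp only [hw, integral_pairing]
    exact tendsto_finsetSum _ fun I _ => (tendsto_pi_nhds.1 (h I.1) I.2).const_mul _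

theorem map_eq_of_integral_signature_eq (hL : Set.InjOn signature L)
    {Ω Ω' : Type*} [MeasurableSpace Ω] [MeasurableSpace Ω'] {P : Measure Ω} {P' : Measure Ω'}
    [IsFiniteMeasure P] [IsFiniteMeasure P'] {X : Ω → L} {X' : Ω' → L} (hX : AEMeasurable X P)
    (hX' : AEMeasurable X' P')
    (h : ∀ m, ∫ ω, (X ω : BVPath n).signature m ∂P = ∫ ω, (X' ω : BVPath n).signature m ∂P') :
    P.map X = P'.map X' := by
  refine measure_eq_of_integral_signature_eq hL fun m => ?_
  have hsig : Continuous fun x : L => (x : BVPath n).signature m :=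
    (continuous_signature m).comp continuous_subtype_val
  exact (integral_map hX hsig.aestronglyMeasurable).trans
    ((h m).trans (integral_map hX' hsig.aestronglyMeasurable).symm)

theorem tendsto_integral_iff_tendsto_integral_signature (hL : Set.InjOn signature L)
    {ι : Type*} {l : Filter ι} {Ω : Type*} [MeasurableSpace Ω] {P : Measure Ω}
    [IsProbabilityMeasure P] {X : Ω → L} {Ω' : ι → Type*} [∀ k, MeasurableSpace (Ω' k)]
    {P' : ∀ k, Measure (Ω' k)} [∀ k, IsProbabilityMeasure (P' k)] {X' : ∀ k, Ω' k → L}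
    (hX : AEMeasurable X P) (hX' : ∀ k, AEMeasurable (X' k) (P' k)) :
    (∀ f : L →ᵇ ℝ, Tendsto (fun k => ∫ ω, f (X' k ω) ∂(P' k)) l (𝓝 (∫ ω, f (X ω) ∂P))) ↔
      ∀ m, Tendsto (fun k => ∫ ω, (X' k ω : BVPath n).signature m ∂(P' k)) l
        (𝓝 (∫ ω, (X ω : BVPath n).signature m ∂P)) := by
  let law : ProbabilityMeasure L := ⟨P.map X, Measure.isProbabilityMeasure_map hX⟩
  let law' (k : ι) : ProbabilityMeasure L :=
    ⟨(P' k).map (X' k), Measure.isProbabilityMeasure_map (hX' k)⟩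
  have hlaw {E : Type} [NormedAddCommGroup E] [NormedSpace ℝ E] {F : L → E} (hF : Continuous F) :
      ∫ x, F x ∂law = ∫ ω, F (X ω) ∂P := integral_map hX hF.aestronglyMeasurable
  have hlaw' {E : Type} [NormedAddCommGroup E] [NormedSpace ℝ E] {F : L → E} (hF : Continuous F)
      (k : ι) : ∫ x, F x ∂law' k = ∫ ω, F (X' k ω) ∂(P' k) :=
    integral_map (hX' k) hF.aestronglyMeasurable
  have hsig (m : ℕ) : Continuous fun x : L => (x : BVPath n).signature m :=
    (continuous_signature m).comp continuous_subtype_val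
  have hweak := ProbabilityMeasure.tendsto_iff_forall_integral_tendsto.symm.trans
    (tendsto_iff_tendsto_integral_signature hL (l := l) (μ := law') (ν := law))
  simpa only [hlaw (hsig _), hlaw' (hsig _), hlaw (BoundedContinuousFunction.continuous _),
    hlaw' (BoundedContinuousFunction.continuous _)] using hweak

end LinearFunctionals

theorem aemeasurable_augmentOn_comp {K : Set (BVPath n)} {Ω : Type*} [MeasurableSpace Ω]
    {X : Ω → K} (hX : Measurable X) (P : Measure Ω) :
    AEMeasurable (fun ω => augmentOn K (X ω)) P :=
  ((continuous_augmentOn K).measurable.comp hX).aemeasurable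

theorem injOn_signature_image_timeAugment (K : Set (BVPath n)) :
    Set.InjOn signature (timeAugment '' K) := by
  rintro _ ⟨x, -, rfl⟩ _ ⟨y, -, rfl⟩ hxy
  rw [injective_signature_timeAugment hxy]

end BVPath

theorem mainTheorem2 (d : ℕ) (K : Set (BVPath d)) (hK : IsCompact K) :
    -- uniform density of the linear functionals of the signature
    (∀ f : (BVPath.timeAugment '' K) →ᵇ ℝ, ∀ ε : ℝ, 0 < ε →
      ∃ w : (Σ m : ℕ, (Fin m → Fin (d + 1))) →₀ ℝ,
        (⨆ x : K, ‖f (BVPath.augmentOn K x) -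
          BVPath.pairing w (BVPath.timeAugment (x : BVPath d))‖ₑ) < ENNReal.ofReal ε) ∧
    -- the expected signature of a `K`-valued random variable exists
    (∀ (Ω : Type*) [MeasurableSpace Ω] (P : Measure Ω) [IsProbabilityMeasure P] (X : Ω → K),
      Measurable X → ∀ m : ℕ,
        Integrable (fun ω => (BVPath.timeAugment (X ω : BVPath d)).signature m) P) ∧
    -- the expected signature determines the law
    (∀ (Ω : Type*) [MeasurableSpace Ω] (P : Measure Ω) [IsProbabilityMeasure P] (X : Ω → K)
      (Ω' : Type*) [MeasurableSpace Ω'] (P' : Measure Ω') [IsProbabilityMeasure P'] (X' : Ω' → K),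
      Measurable X → Measurable X' →
      (∀ m : ℕ, ∫ ω, (BVPath.timeAugment (X ω : BVPath d)).signature m ∂P =
        ∫ ω, (BVPath.timeAugment (X' ω : BVPath d)).signature m ∂P') →
      P.map (fun ω => BVPath.augmentOn K (X ω)) =
        P'.map (fun ω => BVPath.augmentOn K (X' ω))) ∧
    -- weak convergence is convergence of the expected signature in every degree
    (∀ (Ω : Type*) [MeasurableSpace Ω] (P : Measure Ω) [IsProbabilityMeasure P] (X : Ω → K)
      (Ω' : ℕ → Type*) [∀ k, MeasurableSpace (Ω' k)] (P' : ∀ k, Measure (Ω' k))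
      [∀ k, IsProbabilityMeasure (P' k)] (X' : ∀ k, Ω' k → K),
      Measurable X → (∀ k, Measurable (X' k)) →
      ((∀ f : (BVPath.timeAugment '' K) →ᵇ ℝ,
          Tendsto (fun k => ∫ ω, f (BVPath.augmentOn K (X' k ω)) ∂(P' k)) atTop
            (𝓝 (∫ ω, f (BVPath.augmentOn K (X ω)) ∂P))) ↔
        ∀ m : ℕ,
          Tendsto (fun k => ∫ ω, (BVPath.timeAugment (X' k ω : BVPath d)).signature m ∂(P' k)) atTop
            (𝓝 (∫ ω, (BVPath.timeAugment (X ω : BVPath d)).signature m ∂P)))) := by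
  have : CompactSpace (BVPath.timeAugment '' K) :=
    isCompact_iff_compactSpace.1 (hK.image BVPath.continuous_timeAugment)
  have hinj := BVPath.injOn_signature_image_timeAugment K
  refine ⟨fun f ε hε => ?_, fun Ω _ P _ X hX m => ?_, fun Ω _ P _ X Ω' _ P' _ X' hX hX' h => ?_,
    fun Ω _ P _ X Ω' _ P' _ X' hX hX' => ?_⟩
  · obtain ⟨w, hw⟩ := BVPath.exists_forall_abs_sub_pairing_lt hinj f (half_pos hε)
    refine ⟨w, (iSup_le fun x => ?_).trans_lt
      ((ENNReal.ofReal_lt_ofReal_iff hε).2 (half_lt_self hε))⟩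
    rw [Real.enorm_eq_ofReal_abs]
    exact ENNReal.ofReal_le_ofReal (hw (BVPath.augmentOn K x)).le
  · exact (BVPath.integrable_signature (P.map _) m).comp_aemeasurable
      (BVPath.aemeasurable_augmentOn_comp hX P)
  · exact BVPath.map_eq_of_integral_signature_eq hinj (BVPath.aemeasurable_augmentOn_comp hX P)
      (BVPath.aemeasurable_augmentOn_comp hX' P') h
  · exact BVPath.tendsto_integral_iff_tendsto_integral_signature hinj
      (BVPath.aemeasurable_augmentOn_comp hX P)
      fun k => BVPath.aemeasurable_augmentOn_comp (hX' k) (P' k)
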